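/- Consider the $K$-user linear interference network in which transmitter $j\in\{1,\dots,K\}$ can reach only receivers $j$ and $j+1$ (transmitter $K$ only receiver $K$), and each of these links is erased independently with probability $p$. A message assignment gives each message $W_i$ (intended for receiver $i$) a transmit set ${\cal T}_i\subseteq[K]$ with $|{\cal T}_i|\le 1$; it is fixed before the erasures are known. For a realization of the erasures, an orthogonal TDMA scheme is a choice of a set of active receivers such that each active receiver is connected to the transmitter carrying its message and is not connected to the transmitter carrying the message of any other active receiver; each active receiver has one degree of freedom (DoF), so the sum DoF is the number of active receivers. For a given assignment, take the largest TDMA sum DoF in each realization and average it over the realizations; let $\eta_p^{(\mathrm{TDMA})}(K)$ be the maximum of this average over all assignments, and let $\tau_p^{(\mathrm{TDMA})}=\lim_{K\to\infty}\eta_p^{(\mathrm{TDMA})}(K)/K$. Put $$\tau_p^{(1)}=\tfrac12\left(1-p+(1-p)\left(1-(1-p)^2\right)^2\right)+\sum_{i=1}^{\infty}\tfrac12\left(1-(1-p)^2\right)^2(1-p)^{4i+1},$$ $$\tau_p^{(2)}=\tfrac23(1-p)+\tfrac13p(1-p)\left(1-(1-p)^2\right),$$ $$\tau_p^{(3)}=\tfrac12(1-p)+\tfrac14(1-p)\left(1-(1-p)^2\right)\left(1+p+(1-p)^3\right).$$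 An assignment is irreducible if ${\cal T}_1=\{1\}$ and, for every $i\ge 2$, ${\cal T}_i=\{i-1\}$ or ${\cal T}_i=\{i\}$. A ternary string $S=(S_1,\dots,S_n)\in\{0,1,2\}^n$, $n\ge1$, with $\sum_i S_i=n$ is called irreducible if for every $K\ge n$ there is an irreducible assignment in which transmitter $t$ carries $S_{((t-1)\bmod n)+1}$ messages for $t\le n\lfloor K/n\rfloor$ and one message for $n\lfloor K/n\rfloor<t\le K$; these assignments form the strategy defined by $S$. The average per-user DoF of the strategy is the limit, as $K\to\infty$, of its average TDMA sum DoF divided by $K$. **Theorem.** Let $0\le p\le1$. 1. The limit $\tau_p^{(\mathrm{TDMA})}$ exists and $\tau_p^{(\mathrm{TDMA})}=\max\{\tau_p^{(1)},\tau_p^{(2)},\tau_p^{(3)}\}$. 2. The strings $(1)$, $(2,1,0)$ and $(1,2,1,0)$ are irreducible, and under restriction to orthogonal TDMA schemes their strategies have average per-user DoF $\tau_p^{(1)}$, $\tau_p^{(2)}$ and $\tau_p^{(3)}$, respectively. 3. For every $n\ge0$ the strings $(2,1,\dots,1,0)$ and $(1,\dots,1,2,0)$ with $n$ ones are irreducible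 and their strategies have the same average per-user DoF, which is at most $\frac{n-1}{n+2}\tau_p^{(1)}+\frac{3}{n+2}\tau_p^{(2)}$ if $n$ is odd and at most $\frac{n}{n+2}\tau_p^{(1)}+\frac{2}{n+2}\tau_p^{(2)}$ if $n$ is even. 4. All strings $(1,\dots,1,2,1,\dots,1,0)$ with at least one $1$ on each side of the $2$ are irreducible, and for every irreducible string the average per-user DoF of its strategy exists and is at most a convex combination of $\tau_p^{(1)},\tau_p^{(2)},\tau_p^{(3)}$ (with weights that may depend on the string and on $p$). -/

import Mathlib

open Filter Topology

noncomputable section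

namespace WynerTDMA

/-- The links `(receiver, transmitter)` of the `K`-user linear network: transmitter `j` reaches
receiver `j` and, when it exists, receiver `j + 1`. -/
abbrev Link (K : ℕ) : Type :=
  {l : Fin K × Fin K // (l.1 : ℕ) = (l.2 : ℕ) ∨ (l.1 : ℕ) = (l.2 : ℕ) + 1}

/-- A network realization: which links are present (`true`) and which are erased (`false`). -/
abbrev Realization (K : ℕ) : Type := Link K → Bool

/-- In the realization `ω`, transmitter `t` is connected to receiver `r`. -/
def Connected {K : ℕ} (ω : Realization K) (r t : Fin K) : Prop :=
  ∃ h : (r : ℕ) = (t : ℕ) ∨ (r : ℕ) = (t : ℕ) + 1, ω ⟨(r, t), h⟩ = true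

/-- The probability of a realization when every link is erased independently with
probability `p`. -/
def prob {K : ℕ} (p : ℝ) (ω : Realization K) : ℝ :=
  ∏ l : Link K, if ω l = true then 1 - p else p

/-- A message assignment: the transmit set of every receiver. -/
abbrev Assignment (K : ℕ) : Type := Fin K → Finset (Fin K)

/-- The cooperation order constraint: every message is available at at most `M` transmitters. -/
def CoopOrder {K : ℕ} (M : ℕ) (T : Assignment K) : Prop := ∀ i, (T i).card ≤ M

/-- `A` is the set of active receivers of an orthogonal TDMA scheme (assignments with at most one
transmitter per message): every active receiver is connected to the transmitter of its message
and is not connected to the transmitter of any other active message. -/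
def IsTDMA {K : ℕ} (ω : Realization K) (T : Assignment K) (A : Finset (Fin K)) : Prop :=
  ∀ i ∈ A, (∃ t ∈ T i, Connected ω i t) ∧ ∀ j ∈ A, j ≠ i → ∀ t ∈ T j, ¬ Connected ω i t

open Classical in
/-- The largest sum DoF of an orthogonal TDMA scheme in a given realization: one DoF for each
active receiver. -/
def tdmaDoF {K : ℕ} (ω : Realization K) (T : Assignment K) : ℕ :=
  (Finset.univ.filter fun A : Finset (Fin K) => IsTDMA ω T A).sup Finset.card

/-- The TDMA sum DoF of an assignment, averaged over the network realizations. -/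
def avgDoF {K : ℕ} (p : ℝ) (T : Assignment K) : ℝ :=
  ∑ ω : Realization K, prob p ω * (tdmaDoF ω T : ℝ)

/-- The best average TDMA sum DoF of the `K`-user network over all assignments in which each
message is available at no more than one transmitter. -/
def bestAvgDoF (p : ℝ) (K : ℕ) : ℝ :=
  ⨆ T : {T : Assignment K // CoopOrder 1 T}, avgDoF p T.1

/-- Irreducible assignments with one transmitter per message: each message is at exactly one
transmitter, and this transmitter is one of those that can reach the designated receiver. -/
def IsIrreducible {K : ℕ} (T : Assignment K) : Prop :=
  ∀ i, ∃ t, T i = {t} ∧ ((i : ℕ) = (t : ℕ) ∨ (i : ℕ) = (t : ℕ) + 1)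

/-- The number of messages available at transmitter `t`. -/
def load {K : ℕ} (T : Assignment K) (t : Fin K) : ℕ :=
  (Finset.univ.filter fun i : Fin K => t ∈ T i).card

/-- The number of messages at transmitter `t` (counted from `0`) in the `K`-user network prescribed
by the string `S`: full periods of `S`, then ones. -/
def stringLoad (S : List ℕ) (K t : ℕ) : ℕ :=
  if t < S.length * (K / S.length) then S.getD (t % S.length) 0 else 1

/-- The assignments `T K` (irrelevant for `K` below the length of the string) are irreducible and
have the loads prescribed by `S`. -/
def DefinedBy (S : List ℕ) (T : (K : ℕ) → Assignment K) : Prop :=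
  ∀ K, S.length ≤ K → IsIrreducible (T K) ∧ ∀ t : Fin K, load (T K) t = stringLoad S K t

/-- Ternary strings of length `n ≥ 1` and sum `n` that define irreducible assignments. -/
def IsIrreducibleString (S : List ℕ) : Prop :=
  S ≠ [] ∧ (∀ s ∈ S, s ≤ 2) ∧ S.sum = S.length ∧ ∃ T, DefinedBy S T

/-- `S` is an irreducible string, and the asymptotic average per user DoF under restriction to
TDMA schemes and to the strategy defined by `S` exists and equals `L`. -/
def HasStringDoF (p : ℝ) (S : List ℕ) (L : ℝ) : Prop :=
  IsIrreducibleString S ∧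
    ∀ T : (K : ℕ) → Assignment K, DefinedBy S T →
      Tendsto (fun K : ℕ => avgDoF p (T K) / (K : ℝ)) atTop (𝓝 L)

/-- The string `(2, 1, …, 1, 0)` with `n` ones. -/
def stringTwoFirst (n : ℕ) : List ℕ := 2 :: (List.replicate n 1 ++ [0])

/-- The string `(1, …, 1, 2, 0)` with `n` ones. -/
def stringTwoLast (n : ℕ) : List ℕ := List.replicate n 1 ++ [2, 0]

/-- The string `(1, …, 1, 2, 1, …, 1, 0)` with `a` ones before the two and `b` ones after it. -/
def stringTwoMiddle (a b : ℕ) : List ℕ := List.replicate a 1 ++ 2 :: (List.replicate b 1 ++ [0])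

/-- The value for the string `(1)`. -/
def tau1 (p : ℝ) : ℝ :=
  1 / 2 * (1 - p + (1 - p) * (1 - (1 - p) ^ 2) ^ 2) +
    ∑' i : ℕ, 1 / 2 * (1 - (1 - p) ^ 2) ^ 2 * (1 - p) ^ (4 * (i + 1) + 1)

/-- The value for the string `(2, 1, 0)`. -/
def tau2 (p : ℝ) : ℝ :=
  2 / 3 * (1 - p) + 1 / 3 * p * (1 - p) * (1 - (1 - p) ^ 2)

/-- The value for the string `(1, 2, 1, 0)`. -/
def tau3 (p : ℝ) : ℝ :=
  1 / 2 * (1 - p) + 1 / 4 * (1 - p) * (1 - (1 - p) ^ 2) * (1 + p + (1 - p) ^ 3)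

/-- The series in `tau1` converges. -/
theorem tau1_summable (p : ℝ) (hp0 : 0 ≤ p) (hp1 : p ≤ 1) :
    Summable fun i : ℕ => 1 / 2 * (1 - (1 - p) ^ 2) ^ 2 * (1 - p) ^ (4 * (i + 1) + 1) := by
  rcases hp0.eq_or_lt with rfl | hp
  · simp
  · have h0 : (0 : ℝ) ≤ 1 - p := by linarith
    have h1 : (1 - p) ^ 4 < 1 := pow_lt_one₀ h0 (by linarith) (by norm_num)
    have h2 : Summable fun i : ℕ => ((1 - p) ^ 4) ^ i :=
      summable_geometric_of_lt_one (by positivity) h1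
    refine (h2.mul_left (1 / 2 * (1 - (1 - p) ^ 2) ^ 2 * (1 - p) ^ 5)).congr fun i => ?_
    rw [← pow_mul, mul_assoc _ ((1 - p) ^ 5), ← pow_add]
    congr 2
    ring

end WynerTDMA

end

noncomputable section

namespace WynerTDMA

/-! ### Expectations over the realizations -/

/-! A receiver can be active only if its message is at a transmitter that reaches it, so every
assignment is dominated by an irreducible one (`avgDoF_le_assign_code`), that is, by a binary
sequence `c`. For such an assignment only consecutive users can conflict, so an optimal schedule is
a maximum independent set in a subgraph of a path, and the greedy choice finds one
(`tdmaDoF_assign`). Each greedy decision consults links beyond those used before. With q = 1 - p,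
the activation probabilities therefore satisfy u_{i+1} = q(1 - e u_i), where e ∈ {0, q, 1} depends
only on c_i and c_{i+1} (`expect_greedy`).

A step 1 → 0 in `c` has e = 0 and restarts the recursion, so `c` splits into blocks 0^a 1^b. Put r =
q/(1+q²) and d_a = 1 - (-q²)^a. Solving the recursion gives a block the value (a+b)r + r²(q² - (d_a
- q)(d_b - q)) (`blockDoF_eq`). For a ≥ 1 the number d_a lies between d_2 and d_1, so apart from the
block (1,1), which is no better than r per user, the best correction comes from (2,1) or (2,2). No
block exceeds its length times the maximum M of the three values (`blockDoF_le`), whence the bound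
K·M + 1 (`sum_activeProb_le`).

The loads of a string determine `c` on the full periods, so its DoF is a period average and the
three named strings attain their values. Every string is a competitor in the optimum, which gives
the convex combination: all the weight goes to the largest value. -/

/-- The expectation of `f` over the network realizations. -/
def expect {K : ℕ} (p : ℝ) (f : Realization K → ℝ) : ℝ := ∑ ω, prob p ω * f ω

theorem expect_one {K : ℕ} (p : ℝ) : expect p (fun _ : Realization K => 1) = 1 := by
  have h := Finset.prod_univ_sum (fun _ : Link K => (Finset.univ : Finset Bool))
    (fun _ b => if b = true then 1 - p else p)
  simp only [expect, prob, mul_one]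
  rw [← Fintype.piFinset_univ, ← h]
  simp

theorem expect_sub {K : ℕ} (p : ℝ) (f g : Realization K → ℝ) :
    expect p (fun ω => f ω - g ω) = expect p f - expect p g := by
  simp [expect, mul_sub, Finset.sum_sub_distrib]

theorem expect_sum {K : ℕ} (p : ℝ) {ι : Type*} (s : Finset ι) (f : ι → Realization K → ℝ) :
    expect p (fun ω => ∑ i ∈ s, f i ω) = ∑ i ∈ s, expect p (f i) := by
  simp only [expect, Finset.mul_sum]
  rw [Finset.sum_comm]

theorem prob_nonneg {K : ℕ} {p : ℝ} (hp0 : 0 ≤ p) (hp1 : p ≤ 1) (ω : Realization K) :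
    0 ≤ prob p ω :=
  Finset.prod_nonneg fun l _ => by split_ifs <;> linarith

theorem prob_update {K : ℕ} (p : ℝ) (ω : Realization K) (l : Link K) (b : Bool) :
    prob p (Function.update ω l b) =
      (if b = true then 1 - p else p) *
        ∏ l' ∈ Finset.univ.erase l, if ω l' = true then 1 - p else p := by
  rw [prob, ← Finset.mul_prod_erase _ _ (Finset.mem_univ l)]
  congr 1
  · simp
  · refine Finset.prod_congr rfl fun l' hl' => ?_
    rw [Function.update_of_ne (Finset.ne_of_mem_erase hl')]

/-- A link is independent of every quantity that does not depend on it. -/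
theorem expect_link_mul {K : ℕ} (p : ℝ) (l : Link K) (f : Realization K → ℝ)
    (hf : ∀ ω b, f (Function.update ω l b) = f ω) :
    expect p (fun ω => (if ω l = true then 1 else 0) * f ω) = (1 - p) * expect p f := by
  -- Each realization is paired with its flip at `l`. Exactly one member of a pair has the link, and
  -- both have the same value of `f`.
  have hflip : Function.Involutive
      (fun ω : Realization K => Function.update ω l (!ω l)) := by
    intro ω
    simp
  have key : ∀ g : Realization K → ℝ, ∑ ω, g ω = ∑ ω, g (Function.update ω l (!ω l)) :=
    fun g => (Equiv.sum_comp hflip.toPerm g).symm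
  have h2 : ∀ ω : Realization K,
      prob p ω * ((if ω l = true then 1 else 0) * f ω) +
        prob p (Function.update ω l (!ω l)) *
          ((if Function.update ω l (!ω l) l = true then 1 else 0) *
            f (Function.update ω l (!ω l))) =
      (1 - p) * (prob p ω * f ω + prob p (Function.update ω l (!ω l)) *
        f (Function.update ω l (!ω l))) := by
    intro ω
    rw [hf, prob_update]
    have h3 := prob_update p ω l (ω l)
    rw [Function.update_eq_self] at h3
    rw [h3]
    cases ω l <;> simp <;> ring
  have h4 := Finset.sum_congr (rfl : (Finset.univ : Finset (Realization K)) = _)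
    fun ω _ => h2 ω
  rw [Finset.sum_add_distrib, ← Finset.mul_sum, Finset.sum_add_distrib,
    ← key (fun ω => prob p ω * ((if ω l = true then 1 else 0) * f ω)),
    ← key (fun ω => prob p ω * f ω)] at h4
  simp only [expect]
  linarith

/-! ### Links numbered along the network -/

/-- The state of the `n`-th link, where the link from transmitter `t` to receiver `r` has number
`r + t`. -/
def linkState {K : ℕ} (ω : Realization K) (n : ℕ) : Bool :=
  if h : n + 1 < 2 * K then ω ⟨(⟨(n + 1) / 2, by omega⟩, ⟨n / 2, by omega⟩), by simp; omega⟩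
  else false

/-- A link is recovered from its number n: the receiver is ⌈n/2⌉ and the transmitter ⌊n/2⌋. The
network is thus a path of links 0, …, 2K - 2. -/
theorem connected_iff {K : ℕ} (ω : Realization K) (r t : Fin K) :
    Connected ω r t ↔
      ((r : ℕ) = t ∨ (r : ℕ) = t + 1) ∧ linkState ω (r + t) = true := by
  have hr := r.2
  have ht := t.2
  constructor
  · rintro ⟨h, hω⟩
    refine ⟨h, ?_⟩
    rw [linkState, dif_pos (by omega)]
    convert hω using 4 <;> simp only [Fin.ext_iff] <;> omega
  · rintro ⟨h, hω⟩
    refine ⟨h, ?_⟩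
    rw [linkState, dif_pos (by omega)] at hω
    convert hω using 4 <;> simp only [Fin.ext_iff] <;> omega

theorem linkState_update {K : ℕ} (ω : Realization K) (l : Link K) (b : Bool) (n : ℕ)
    (hn : n ≠ (l.1.1 : ℕ) + l.1.2) :
    linkState (Function.update ω l b) n = linkState ω n := by
  unfold linkState
  split_ifs with h
  · rw [Function.update_of_ne]
    rintro rfl
    simp at hn
    omega
  · rfl

theorem expect_linkState_mul {K : ℕ} (p : ℝ) (n : ℕ) (hn : n + 1 < 2 * K)
    (f : (ℕ → Bool) → ℝ)
    (hf : ∀ s s' : ℕ → Bool, (∀ m, m ≠ n → s m = s' m) → f s = f s') :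
    expect p (fun ω : Realization K =>
      (if linkState ω n = true then 1 else 0) * f (linkState ω)) =
      (1 - p) * expect p (fun ω : Realization K => f (linkState ω)) := by
  have h := expect_link_mul p
    (⟨(⟨(n + 1) / 2, by omega⟩, ⟨n / 2, by omega⟩), by simp; omega⟩ : Link K)
    (fun ω => f (linkState ω)) (fun ω b => hf _ _ fun m hm => linkState_update _ _ _ _ (by
      simp; omega))
  rw [← h]
  simp only [linkState, dif_pos hn]

/-! ### Irreducible assignments as binary sequences -/

/-- The irreducible assignment in which message `i` is at transmitter `i - 1` if `c i`, and at
transmitter `i` otherwise. -/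
def assign (c : ℕ → Bool) (K : ℕ) : Assignment K := fun i =>
  -- At i = 0 the subtraction truncates; the lemmas about reachability assume `c 0 = false`.
  if c i = true then {⟨(i : ℕ) - 1, by have := i.2; omega⟩} else {i}

/-- The binary sequence recording which messages are at the transmitter preceding their
receiver. -/
def code {K : ℕ} (T : Assignment K) (n : ℕ) : Bool :=
  open Classical in decide (∃ i : Fin K, (i : ℕ) = n ∧ ∃ t ∈ T i, (i : ℕ) = t + 1)

theorem code_zero {K : ℕ} (T : Assignment K) : code T 0 = false := by
  simp only [code, decide_eq_false_iff_not]
  rintro ⟨i, hi, t, -, ht⟩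
  omega

theorem code_of_le {K : ℕ} (T : Assignment K) {n : ℕ} (hn : K ≤ n) : code T n = false := by
  simp only [code, decide_eq_false_iff_not]
  rintro ⟨i, hi, -⟩
  have := i.2
  omega

theorem code_val {K : ℕ} (T : Assignment K) (i : Fin K) :
    code T i = true ↔ ∃ t ∈ T i, (i : ℕ) = t + 1 := by
  simp only [code, decide_eq_true_eq]
  constructor
  · rintro ⟨j, hj, h⟩
    obtain rfl := Fin.ext hj
    exact h
  · exact fun h => ⟨i, rfl, h⟩

theorem assign_code_apply {K : ℕ} (T : Assignment K) (i t : Fin K) (h : T i = {t})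
    (ht : (i : ℕ) = t ∨ (i : ℕ) = t + 1) : assign (code T) K i = T i := by
  have h1 := code_val T i
  simp only [h, Finset.mem_singleton, exists_eq_left] at h1
  unfold assign
  split_ifs with hc
  · rw [h, Finset.singleton_inj]
    have := h1.1 hc
    ext
    simp
    omega
  · rw [h, Finset.singleton_inj]
    ext
    rw [h1] at hc
    omega

theorem assign_code {K : ℕ} {T : Assignment K} (h : IsIrreducible T) :
    assign (code T) K = T := by
  funext i
  obtain ⟨t, h1, h2⟩ := h i
  exact assign_code_apply T i t h1 h2

theorem isIrreducible_assign {c : ℕ → Bool} (hc : c 0 = false) (K : ℕ) :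
    IsIrreducible (assign c K) := by
  intro i
  unfold assign
  split_ifs with h
  · refine ⟨_, rfl, Or.inr ?_⟩
    have : (i : ℕ) ≠ 0 := by
      intro h0
      rw [h0, hc] at h
      simp at h
    simp
    omega
  · exact ⟨i, rfl, Or.inl rfl⟩

theorem IsIrreducible.coopOrder {K : ℕ} {T : Assignment K} (h : IsIrreducible T) :
    CoopOrder 1 T := by
  intro i
  obtain ⟨t, h1, -⟩ := h i
  simp [h1]

theorem mem_assign {c : ℕ → Bool} (hc : c 0 = false) {K : ℕ} (i t : Fin K) :
    t ∈ assign c K i ↔ (i : ℕ) = t + (c i).toNat := by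
  unfold assign
  by_cases h : c i = true
  · have : (i : ℕ) ≠ 0 := by
      intro h0
      rw [h0, hc] at h
      simp at h
    simp [h, Fin.ext_iff]
    omega
  · simp only [Bool.not_eq_true] at h
    simp [h, Fin.ext_iff]
    omega

/-- Transmitter t carries message t unless it is shifted away, and message t + 1 if that one is
shifted here. `hK` covers the last transmitter, which has no next message. -/
theorem load_assign {c : ℕ → Bool} (hc : c 0 = false) {K : ℕ} (hK : c K = false) (t : Fin K) :
    load (assign c K) t + (c t).toNat = 1 + (c (t + 1)).toNat := by
  have hset : (Finset.univ.filter fun i : Fin K => t ∈ assign c K i) =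
      (if c t = true then ∅ else {t}) ∪
        (if h : (t : ℕ) + 1 < K then
          (if c (t + 1) = true then {⟨(t : ℕ) + 1, h⟩} else ∅) else ∅) := by
    ext i
    rw [Finset.mem_filter, mem_assign hc]
    simp only [Finset.mem_univ, true_and, Finset.mem_union]
    constructor
    · intro h
      cases hci : c i
      · rw [hci] at h
        simp only [Bool.toNat_false, add_zero] at h
        left
        rw [← h, hci]
        simp [Fin.ext_iff, h]
      · rw [hci] at h
        simp only [Bool.toNat_true] at h
        right
        have h' : (t : ℕ) + 1 < K := by have := i.2; omega
        rw [dif_pos h', if_pos (h ▸ hci)]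
        simp [Fin.ext_iff, h]
    · rintro (h | h)
      · split_ifs at h with h1
        · simp at h
        · rw [Finset.mem_singleton] at h
          subst h
          simp at h1
          simp [h1]
      · split_ifs at h with h1 h2
        · rw [Finset.mem_singleton] at h
          subst h
          simp [h2]
        · simp at h
        · simp at h
  unfold load
  rw [hset, Finset.card_union_of_disjoint]
  · by_cases h : (t : ℕ) + 1 < K
    · rw [dif_pos h]
      cases c t <;> cases c (t + 1) <;> simp
    · have : (t : ℕ) + 1 = K := by have := t.2; omega
      rw [dif_neg h, this, hK]
      cases c t <;> simp
  · split_ifs <;> simp [Fin.ext_iff]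

/-! ### The greedy schedule -/

/-- Whether the users `i` and `i + 1` cannot be active together once they are connected to the
transmitters of their messages. -/
def conflict (c s : ℕ → Bool) (i : ℕ) : Bool :=
  -- In order: both messages shifted, receiver i hears transmitter i over link 2i; both messages at
  -- transmitter i, always a conflict; transmitters i - 1 and i + 1, never one; none shifted,
  -- receiver i + 1 hears transmitter i over link 2i + 1.
  if c (i + 1) then (if c i then s (2 * i) else true)
  else (if c i then false else s (2 * i + 1))

/-- The number of the link that carries message `i`. -/
def ownLink (c : ℕ → Bool) (i : ℕ) : ℕ := 2 * i - (c i).toNat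

/-- The schedule that activates the users greedily from the first to the last one. -/
def greedy (c s : ℕ → Bool) : ℕ → Bool
  | 0 => s (ownLink c 0)
  | i + 1 => s (ownLink c (i + 1)) && !(greedy c s i && conflict c s i)

theorem greedy_own {c s : ℕ → Bool} {i : ℕ} (h : greedy c s i = true) :
    s (ownLink c i) = true := by
  cases i <;> simp_all [greedy]

theorem greedy_not_conflict {c s : ℕ → Bool} {i : ℕ} (h : greedy c s i = true)
    (h' : greedy c s (i + 1) = true) : conflict c s i = false := by
  simp_all [greedy]

/-- Causality of the schedule; it is what makes the decision for user i independent of later links.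
-/
theorem greedy_congr {c s s' : ℕ → Bool} {i : ℕ}
    (h : ∀ m ≤ ownLink c i, s m = s' m) : greedy c s i = greedy c s' i := by
  induction i with
  | zero => simp only [greedy]; exact h _ le_rfl
  | succ i ih =>
    have h1 : ownLink c i ≤ ownLink c (i + 1) := by
      simp only [ownLink]
      have := Bool.toNat_le (c (i + 1))
      omega
    have h2 : conflict c s i = conflict c s' i := by
      unfold conflict ownLink at *
      split_ifs with h3 h4 h4
      · exact h _ (by simp [h3]; omega)
      · rfl
      · rfl
      · exact h _ (by simp at h3; simp [h3])
    simp only [greedy]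
    rw [h _ le_rfl, ih fun m hm => h m (hm.trans h1), h2]

theorem connected_own_iff {c : ℕ → Bool} (hc : c 0 = false) {K : ℕ} (ω : Realization K)
    (i : Fin K) :
    (∃ t ∈ assign c K i, Connected ω i t) ↔ linkState ω (ownLink c i) = true := by
  obtain ⟨t, h1, h2⟩ := isIrreducible_assign hc K i
  have h3 := (mem_assign hc i t).1 (by simp [h1])
  rw [h1]
  simp only [Finset.mem_singleton, exists_eq_left, connected_iff]
  rw [and_iff_right h2]
  have : (i : ℕ) + t = ownLink c i := by unfold ownLink; omega
  rw [this]

theorem isTDMA_conflict {c : ℕ → Bool} (hc : c 0 = false) {K : ℕ} {ω : Realization K}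
    {A : Finset (Fin K)} (hA : IsTDMA ω (assign c K) A) {i j : Fin K} (hi : i ∈ A) (hj : j ∈ A)
    (hij : (j : ℕ) = i + 1) : conflict c (linkState ω) i = false := by
  have hne : j ≠ i := by rintro rfl; omega
  have hi' := hA i hi
  have hj' := hA j hj
  rw [connected_own_iff hc] at hi' hj'
  have h1 := hi'.2 j hj hne
  have h2 := hj'.2 i hi hne.symm
  simp only [mem_assign hc, connected_iff] at h1 h2
  rw [hij] at h1 h2
  unfold conflict
  have h1' := h1 i
  have h2' := h2 i
  cases hci : c i <;> cases hcj : c (i + 1) <;>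
    simp_all [ownLink, two_mul, add_assoc, add_comm, add_left_comm]

theorem isTDMA_greedy {c : ℕ → Bool} (hc : c 0 = false) {K : ℕ} (ω : Realization K) :
    IsTDMA ω (assign c K)
      (Finset.univ.filter fun i : Fin K => greedy c (linkState ω) i = true) := by
  intro i hi
  simp only [Finset.mem_filter, Finset.mem_univ, true_and] at hi
  refine ⟨(connected_own_iff hc ω i).2 (greedy_own hi), ?_⟩
  intro j hj hne t ht hcon
  simp only [Finset.mem_filter, Finset.mem_univ, true_and] at hj
  rw [mem_assign hc] at ht
  rw [connected_iff] at hcon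
  obtain ⟨h1, h2⟩ := hcon
  have hne' : (j : ℕ) ≠ i := fun h => hne (Fin.ext h)
  have hi0 := greedy_own hi
  have hj0 := greedy_own hj
  cases hcj : c j
  · rw [hcj] at ht
    have hij : (i : ℕ) = j + 1 := by simp at ht; omega
    rw [hij] at hi
    have := greedy_not_conflict hj hi
    simp at ht
    have h3 : (i : ℕ) + t = 2 * j + 1 := by omega
    rw [h3] at h2
    simp only [conflict, hcj, h2] at this
    split_ifs at this <;> simp_all
  · rw [hcj] at ht
    have hij : (j : ℕ) = i + 1 := by simp at ht; omega
    rw [hij] at hj hcj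
    have := greedy_not_conflict hi hj
    have h3 : (i : ℕ) + t = 2 * i := by simp at ht; omega
    rw [h3] at h2
    simp only [conflict, hcj, h2] at this
    split_ifs at this

/-- A "greedy stays ahead" argument: the greedy schedule rejects a connected user only when the
preceding one is active and conflicting, and then `A` must have left out that preceding user. -/
theorem IsTDMA.card_le_greedy {c : ℕ → Bool} (hc : c 0 = false) {K : ℕ} {ω : Realization K}
    {A : Finset (Fin K)} (hA : IsTDMA ω (assign c K) A) :
    A.card ≤ ∑ i ∈ Finset.range K, (greedy c (linkState ω) i).toNat := by
  classical
  set a : ℕ → ℕ := fun n => if ∃ i ∈ A, (i : ℕ) = n then 1 else 0 with ha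
  set g := greedy c (linkState ω) with hg
  have hcard : A.card = ∑ n ∈ Finset.range K, a n := by
    rw [Finset.sum_range, Finset.card_eq_sum_ones, ← Finset.sum_filter_add_sum_filter_not
      Finset.univ (fun i : Fin K => i ∈ A)]
    simp only [ha]
    rw [Finset.sum_eq_zero (s := Finset.univ.filter fun i : Fin K => i ∉ A)]
    · rw [add_zero]
      refine Finset.sum_congr (by ext; simp) fun i hi => ?_
      rw [if_pos ⟨i, by simpa using hi, rfl⟩]
    · intro i hi
      simp only [Finset.mem_filter, Finset.mem_univ, true_and] at hi
      rw [if_neg]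
      rintro ⟨j, hj, hji⟩
      rw [Fin.ext hji] at hj
      exact hi hj
  have hown : ∀ n, a n = 1 → linkState ω (ownLink c n) = true := by
    intro n hn
    simp only [ha] at hn
    split_ifs at hn with h
    obtain ⟨i, hi, rfl⟩ := h
    exact (connected_own_iff hc ω i).1 (hA i hi).1
  have hconf : ∀ n, a n = 1 → a (n + 1) = 1 → conflict c (linkState ω) n = false := by
    intro n hn hn'
    simp only [ha] at hn hn'
    split_ifs at hn with h
    split_ifs at hn' with h'
    obtain ⟨i, hi, rfl⟩ := h
    obtain ⟨j, hj, hij⟩ := h'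
    exact isTDMA_conflict hc hA hi hj hij
  have ha01 : ∀ n, a n = 0 ∨ a n = 1 := by
    intro n
    simp only [ha]
    split_ifs <;> simp
  -- The extra term strengthens the induction: if greedy has just served a user that `A` skipped, it
  -- is strictly ahead, which pays for a possible loss at the next user.
  have main : ∀ n, ∑ i ∈ Finset.range (n + 1), a i + (g n).toNat * (1 - a n) ≤
      ∑ i ∈ Finset.range (n + 1), (g i).toNat := by
    intro n
    induction n with
    | zero =>
      simp only [zero_add, Finset.sum_range_one]
      rcases ha01 0 with h | h
      · simp [h]
      · have : g 0 = true := by rw [hg, greedy]; exact hown 0 h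
        simp [h, this]
    | succ n ih =>
      rw [Finset.sum_range_succ a, Finset.sum_range_succ (fun i => (g i).toNat)]
      rcases ha01 (n + 1) with h | h
      · rw [h]; simp; omega
      · rw [h]
        simp only [Nat.sub_self, mul_zero, add_zero]
        cases hgn : g (n + 1)
        · have h1 := hown _ h
          have h2 : g n = true ∧ conflict c (linkState ω) n = true := by
            rw [hg, greedy, h1] at hgn
            simpa using hgn
          have h3 : a n = 0 := by
            rcases ha01 n with h3 | h3
            · exact h3
            · have := hconf n h3 h
              rw [h2.2] at this
              simp at this
          rw [h3, h2.1] at ih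
          simp at ih ⊢
          exact ih
        · simp; omega
  rw [hcard]
  cases K with
  | zero => simp
  | succ n => exact le_trans (Nat.le_add_right _ _) (main n)

theorem card_greedy (c s : ℕ → Bool) (K : ℕ) :
    (Finset.univ.filter fun i : Fin K => greedy c s i = true).card =
      ∑ i ∈ Finset.range K, (greedy c s i).toNat := by
  rw [Finset.sum_range, Finset.card_filter]
  refine Finset.sum_congr rfl fun i _ => ?_
  cases greedy c s i <;> simp

theorem tdmaDoF_assign {c : ℕ → Bool} (hc : c 0 = false) {K : ℕ} (ω : Realization K) :
    tdmaDoF ω (assign c K) = ∑ i ∈ Finset.range K, (greedy c (linkState ω) i).toNat := by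
  unfold tdmaDoF
  apply le_antisymm
  · refine Finset.sup_le fun A hA => ?_
    simp only [Finset.mem_filter, Finset.mem_univ, true_and] at hA
    exact hA.card_le_greedy hc
  · rw [← card_greedy]
    exact Finset.le_sup (f := Finset.card) (by simpa using isTDMA_greedy hc ω)

/-! ### The activation probabilities of the greedy schedule -/

/-- The probability that the greedy schedule activates user `i`, when links are present with
probability `q`. -/
def activeProb (q : ℝ) (c : ℕ → Bool) : ℕ → ℝ
  | 0 => q
  | i + 1 => q * (1 - (if c (i + 1) then (if c i then q else 1) else (if c i then 0 else q)) *
      activeProb q c i)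

/-- The link deciding the conflict, if any, has a number strictly between `ownLink c i` and `ownLink
c (i + 1)`. So the past decision, the conflict and the presence of the next own link are
independent. -/
theorem expect_greedy {c : ℕ → Bool} (hc : c 0 = false) {K : ℕ} (p : ℝ) {i : ℕ} (hi : i < K) :
    expect p (fun ω : Realization K => ((greedy c (linkState ω) i).toNat : ℝ)) =
      activeProb (1 - p) c i := by
  induction i with
  | zero =>
    have h := expect_linkState_mul (K := K) p 0 (by omega) (fun _ => 1) (fun _ _ _ => rfl)
    rw [expect_one, mul_one] at h
    rw [activeProb, ← h]
    congr 1
    funext ω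
    simp only [greedy, ownLink, hc]
    cases h0 : linkState ω 0 <;> simp [h0]
  | succ i ih =>
    have ih := ih (by omega)
    have h1 := expect_linkState_mul (K := K) p (ownLink c (i + 1)) (by unfold ownLink; omega)
      (fun s => 1 - ((greedy c s i).toNat : ℝ) * ((conflict c s i).toNat : ℝ)) (by
        intro s s' hs
        have hg : greedy c s i = greedy c s' i := greedy_congr fun m hm => hs m (by
          unfold ownLink at *
          have := Bool.toNat_le (c (i + 1))
          omega)
        have hcf : conflict c s i = conflict c s' i := by
          unfold conflict ownLink at *
          cases h : c (i + 1) <;> cases h' : c i <;> simp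
          · exact hs _ (by simp [h]; omega)
          · exact hs _ (by simp [h]; omega)
        simp only [hg, hcf])
    have h2 : expect p (fun ω : Realization K => ((greedy c (linkState ω) (i + 1)).toNat : ℝ)) =
        expect p (fun ω : Realization K =>
          (if linkState ω (ownLink c (i + 1)) = true then 1 else 0) *
          (1 - ((greedy c (linkState ω) i).toNat : ℝ) *
            ((conflict c (linkState ω) i).toNat : ℝ))) := by
      congr 1
      funext ω
      rw [greedy]
      cases linkState ω (ownLink c (i + 1)) <;> cases greedy c (linkState ω) i <;>
        cases conflict c (linkState ω) i <;> simp
    rw [h2, h1, expect_sub, expect_one, activeProb, ← ih]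
    congr 2
    have h3 : ∀ n, ownLink c i < n → n + 1 < 2 * K →
        expect p (fun ω : Realization K => ((greedy c (linkState ω) i).toNat : ℝ) *
          ((linkState ω n).toNat : ℝ)) =
        (1 - p) * expect p (fun ω : Realization K => ((greedy c (linkState ω) i).toNat : ℝ)) := by
      intro n hn hn'
      rw [← expect_linkState_mul p n hn' (fun s => ((greedy c s i).toNat : ℝ))]
      · congr 1
        funext ω
        cases linkState ω n <;> simp
      · intro s s' hs
        rw [greedy_congr fun m hm => hs m (by omega)]
    cases h : c (i + 1) <;> cases h' : c i <;> simp only [conflict, h, h'] <;> simp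
    · exact h3 _ (by simp [ownLink]) (by omega)
    · simp [expect]
    · refine h3 _ ?_ (by omega)
      have : i ≠ 0 := by rintro rfl; rw [hc] at h'; simp at h'
      simp [ownLink, h']
      omega

theorem avgDoF_assign {c : ℕ → Bool} (hc : c 0 = false) (p : ℝ) (K : ℕ) :
    avgDoF p (assign c K) = ∑ i ∈ Finset.range K, activeProb (1 - p) c i := by
  have : avgDoF p (assign c K) = expect p (fun ω : Realization K =>
      ∑ i ∈ Finset.range K, ((greedy c (linkState ω) i).toNat : ℝ)) := by
    simp only [avgDoF, expect, tdmaDoF_assign hc, Nat.cast_sum]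
  rw [this, expect_sum]
  exact Finset.sum_congr rfl fun i hi => expect_greedy hc p (Finset.mem_range.1 hi)

/-- `T` and its irreducible version agree on every receiver that is active in some scheme, and
inactive receivers impose no constraint. Each scheme for `T` therefore remains one. -/
theorem avgDoF_le_assign_code {K : ℕ} {p : ℝ} (hp0 : 0 ≤ p) (hp1 : p ≤ 1) {T : Assignment K}
    (hT : CoopOrder 1 T) : avgDoF p T ≤ avgDoF p (assign (code T) K) := by
  refine Finset.sum_le_sum fun ω _ => mul_le_mul_of_nonneg_left ?_ (prob_nonneg hp0 hp1 ω)
  rw [Nat.cast_le]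
  unfold tdmaDoF
  refine Finset.sup_mono ?_
  intro A hA
  simp only [Finset.mem_filter, Finset.mem_univ, true_and] at hA ⊢
  have heq : ∀ i ∈ A, assign (code T) K i = T i := by
    intro i hi
    obtain ⟨t, ht, h, -⟩ := (hA i hi).1
    exact assign_code_apply T i t
      (Finset.eq_singleton_iff_unique_mem.2
        ⟨ht, fun s hs => Finset.card_le_one.1 (hT i) s hs t ht⟩) h
  intro i hi
  rw [heq i hi]
  refine ⟨(hA i hi).1, fun j hj hne => ?_⟩
  rw [heq j hj]
  exact (hA i hi).2 j hj hne

/-! ### Values of blocks -/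

/-- The per-user DoF `q / (1 + q²)` of the string `(1)`. -/
def rate (q : ℝ) : ℝ := q / (1 + q ^ 2)

/-- The sequence `1 - (-q²)^a`. -/
def dev (q : ℝ) (a : ℕ) : ℝ := 1 - (-q ^ 2) ^ a

/-- The expected number of active users in a block of `a` users served by their own transmitters
followed by `b` users served by the preceding ones. -/
def blockDoF (q : ℝ) (a b : ℕ) : ℝ :=
  (a + b) * rate q + rate q ^ 2 * (q * (dev q a + dev q b) - dev q a * dev q b)

theorem blockDoF_comm (q : ℝ) (a b : ℕ) : blockDoF q a b = blockDoF q b a := by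
  unfold blockDoF; ring

/-- `rate q` is the fixed point of u ↦ q(1 - qu). -/
theorem rate_mul (q : ℝ) : rate q * (1 + q ^ 2) = q := by
  unfold rate
  have : 1 + q ^ 2 ≠ 0 := by positivity
  field_simp

theorem tau1_eq {p : ℝ} (hp0 : 0 ≤ p) (hp1 : p ≤ 1) : tau1 p = rate (1 - p) := by
  unfold tau1 rate
  -- At p = 0 the geometric ratio is 1, but all terms vanish.
  rcases hp0.eq_or_lt with rfl | hp
  · norm_num
  · set q := 1 - p with hq
    have hq0 : 0 ≤ q := by linarith
    have hq1 : q < 1 := by linarith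
    have h4 : q ^ 4 < 1 := pow_lt_one₀ hq0 hq1 (by norm_num)
    have h : ∀ i : ℕ, 1 / 2 * (1 - q ^ 2) ^ 2 * q ^ (4 * (i + 1) + 1) =
        (1 / 2 * (1 - q ^ 2) ^ 2 * q ^ 5) * (q ^ 4) ^ i := by
      intro i
      rw [← pow_mul]
      ring
    simp_rw [h]
    rw [tsum_mul_left, tsum_geometric_of_lt_one (by positivity) h4]
    have h1 : 1 + q ^ 2 ≠ 0 := by positivity
    have h2 : 1 - q ^ 4 ≠ 0 := by linarith
    field_simp
    ring

theorem tau2_eq (p : ℝ) : tau2 p = blockDoF (1 - p) 2 1 / 3 := by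
  have h := rate_mul (1 - p)
  unfold tau2 blockDoF dev
  obtain ⟨q, rfl⟩ : ∃ q, p = 1 - q := ⟨1 - p, by ring⟩
  simp only [sub_sub_cancel] at h ⊢
  push_cast
  unfold rate
  have h1 : 1 + q ^ 2 ≠ 0 := by positivity
  field_simp
  ring

theorem tau3_eq (p : ℝ) : tau3 p = blockDoF (1 - p) 2 2 / 4 := by
  unfold tau3 blockDoF dev
  obtain ⟨q, rfl⟩ : ∃ q, p = 1 - q := ⟨1 - p, by ring⟩
  simp only [sub_sub_cancel]
  push_cast
  unfold rate
  have h1 : 1 + q ^ 2 ≠ 0 := by positivity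
  field_simp
  ring

theorem rate_nonneg {q : ℝ} (hq0 : 0 ≤ q) : 0 ≤ rate q := by
  unfold rate; positivity

theorem rate_le_half (q : ℝ) : rate q ≤ 1 / 2 := by
  unfold rate
  rw [div_le_div_iff₀ (by positivity) (by norm_num)]
  nlinarith [sq_nonneg (1 - q)]

theorem abs_neg_sq_pow_le (q : ℝ) (a : ℕ) : |(-q ^ 2) ^ a| ≤ (q ^ 2) ^ a := by
  rw [abs_pow, abs_neg, abs_of_nonneg (by positivity)]

theorem dev_le {q : ℝ} (hq0 : 0 ≤ q) (hq1 : q ≤ 1) (a : ℕ) (ha : 1 ≤ a) : dev q a ≤ dev q 1 := by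
  unfold dev
  have h1 := (abs_le.1 (abs_neg_sq_pow_le q a)).1
  have h2 : (q ^ 2) ^ a ≤ (q ^ 2) ^ 1 :=
    pow_le_pow_of_le_one (by positivity) (pow_le_one₀ hq0 hq1) ha
  simp only [pow_one] at *
  linarith

/-- The deviation (-q²)^a alternates in sign and does not grow in size, so over a ≥ 1 the extremes
of `dev` are at 1 and 2. -/
theorem le_dev {q : ℝ} (hq0 : 0 ≤ q) (hq1 : q ≤ 1) (a : ℕ) (ha : 1 ≤ a) : dev q 2 ≤ dev q a := by
  unfold dev
  rcases ha.eq_or_lt with rfl | ha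
  · nlinarith [sq_nonneg q, sq_nonneg (q ^ 2)]
  · have h1 := (abs_le.1 (abs_neg_sq_pow_le q a)).2
    have h2 : (q ^ 2) ^ a ≤ (q ^ 2) ^ 2 :=
      pow_le_pow_of_le_one (by positivity) (pow_le_one₀ hq0 hq1) ha
    have h3 : (-q ^ 2) ^ 2 = (q ^ 2) ^ 2 := by ring
    linarith

theorem dev_nonneg {q : ℝ} (hq0 : 0 ≤ q) (hq1 : q ≤ 1) (a : ℕ) : 0 ≤ dev q a := by
  unfold dev
  have h1 := (abs_le.1 (abs_neg_sq_pow_le q a)).2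
  have h2 : (q ^ 2) ^ a ≤ 1 := pow_le_one₀ (by positivity) (pow_le_one₀ hq0 hq1)
  linarith

theorem dev_le_two {q : ℝ} (hq0 : 0 ≤ q) (hq1 : q ≤ 1) (a : ℕ) : dev q a ≤ 2 := by
  unfold dev
  have h1 := (abs_le.1 (abs_neg_sq_pow_le q a)).1
  have h2 : (q ^ 2) ^ a ≤ 1 := pow_le_one₀ (by positivity) (pow_le_one₀ hq0 hq1)
  linarith

/-- In this factored form, maximizing the correction means minimizing a product of two numbers from
the same interval. -/
theorem blockDoF_eq (q : ℝ) (a b : ℕ) :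
    blockDoF q a b = (a + b) * rate q + rate q ^ 2 * (q ^ 2 - (dev q a - q) * (dev q b - q)) := by
  unfold blockDoF; ring

theorem blockDoF_le {q : ℝ} (hq0 : 0 ≤ q) (hq1 : q ≤ 1) {M : ℝ} (h1 : rate q ≤ M)
    (h2 : blockDoF q 2 1 / 3 ≤ M) (h3 : blockDoF q 2 2 / 4 ≤ M) {a b : ℕ} (ha : 1 ≤ a)
    (hb : 1 ≤ b) : blockDoF q a b ≤ (a + b) * M := by
  have hd1 : dev q 1 = 1 + q ^ 2 := by unfold dev; ring
  have hA1 := dev_le hq0 hq1 a ha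
  have hA2 := le_dev hq0 hq1 a ha
  have hB1 := dev_le hq0 hq1 b hb
  have hB2 := le_dev hq0 hq1 b hb
  have hr : 0 ≤ rate q ^ 2 := sq_nonneg _
  have e21 := blockDoF_eq q 2 1
  have e22 := blockDoF_eq q 2 2
  have eab := blockDoF_eq q a b
  have ha' : (1 : ℝ) ≤ a := by exact_mod_cast ha
  have hb' : (1 : ℝ) ≤ b := by exact_mod_cast hb
  have hq2 : 0 ≤ (1 - q) ^ 2 := sq_nonneg _
  push_cast at e21 e22
  have hd : 0 ≤ M - rate q := by linarith
  -- users beyond those of a good block only need `rate q ≤ M`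
  have lift : ∀ (k : ℝ) (x : ℝ), k ≤ a + b → k * rate q + x ≤ k * M →
      rate q ^ 2 * (q ^ 2 - (dev q a - q) * (dev q b - q)) ≤ x →
      blockDoF q a b ≤ (a + b) * M := by
    intro k x hk hx hle
    nlinarith [mul_nonneg (sub_nonneg.2 hk) hd]
  -- Here the correction has the sign of q² - (1 + q² - q)² = -(1 - q)²(1 + q²), so it does not
  -- help.
  by_cases h11 : a = 1 ∧ b = 1
  · obtain ⟨rfl, rfl⟩ := h11
    refine lift 0 0 (by linarith) (by simp) ?_
    refine mul_nonpos_of_nonneg_of_nonpos hr ?_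
    rw [hd1]
    nlinarith
  have h3ab : 3 ≤ a + b := by omega
  have h3ab' : (3 : ℝ) ≤ a + b := by exact_mod_cast h3ab
  have hf1 : 0 ≤ dev q 1 - q := by rw [hd1]; nlinarith
  -- If the lower end of the interval is nonpositive, the least product pairs it with the upper end:
  -- block (2,1). Otherwise it is the square of the lower end, block (2,2), which needs four users;
  -- three users leave only (2,1) and its mirror image.
  by_cases hneg : dev q 2 - q ≤ 0
  · refine lift 3 (rate q ^ 2 * (q ^ 2 - (dev q 2 - q) * (dev q 1 - q))) h3ab' (by linarith) ?_
    refine mul_le_mul_of_nonneg_left ?_ hr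
    by_cases hA0 : 0 ≤ dev q a - q
    · nlinarith [mul_nonneg hA0 (sub_nonneg.2 hB2),
        mul_nonneg (sub_nonneg.2 hA1) (neg_nonneg.2 hneg)]
    · push Not at hA0
      nlinarith [mul_nonneg (neg_nonneg.2 hA0.le) (sub_nonneg.2 hB1),
        mul_nonneg (sub_nonneg.2 hA2) hf1]
  · push Not at hneg
    by_cases h4 : 4 ≤ a + b
    · refine lift 4 (rate q ^ 2 * (q ^ 2 - (dev q 2 - q) * (dev q 2 - q)))
        (by exact_mod_cast h4) (by linarith) ?_
      refine mul_le_mul_of_nonneg_left ?_ hr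
      nlinarith [mul_nonneg hneg.le (sub_nonneg.2 hB2),
        mul_nonneg (sub_nonneg.2 hA2) (le_trans hneg.le (sub_le_sub_right hB2 q))]
    · have : (a = 1 ∧ b = 2) ∨ (a = 2 ∧ b = 1) := by omega
      rcases this with ⟨rfl, rfl⟩ | ⟨rfl, rfl⟩
      · rw [blockDoF_comm]; push_cast; linarith
      · push_cast; linarith

theorem blockDoF_one_le_of_odd {q : ℝ} (hq0 : 0 ≤ q) (hq1 : q ≤ 1) (n : ℕ) :
    blockDoF q 1 (n + 1) ≤ ((n : ℝ) - 1) * rate q + blockDoF q 2 1 := by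
  rw [blockDoF_eq, blockDoF_eq]
  have hd1 : dev q 1 = 1 + q ^ 2 := by unfold dev; ring
  have h1 := le_dev hq0 hq1 (n + 1) (by omega)
  have hf1 : 0 ≤ dev q 1 - q := by rw [hd1]; nlinarith [sq_nonneg (1 - q)]
  have h2 : rate q ^ 2 * (q ^ 2 - (dev q 1 - q) * (dev q (n + 1) - q)) ≤
      rate q ^ 2 * (q ^ 2 - (dev q 2 - q) * (dev q 1 - q)) := by
    refine mul_le_mul_of_nonneg_left ?_ (sq_nonneg _)
    nlinarith [mul_nonneg (sub_nonneg.2 h1) hf1]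
  push_cast
  linarith

/-- For even n the power (-q²)^(n+1) is nonpositive, so `dev q (n + 1)` is at least 1. Inserting
this bound reduces the claim to the polynomial inequality `hpoly`. -/
theorem blockDoF_one_le_of_even {q : ℝ} (hq0 : 0 ≤ q) (hq1 : q ≤ 1) {n : ℕ} (hn : Even n) :
    blockDoF q 1 (n + 1) ≤ (n : ℝ) * rate q + 2 / 3 * blockDoF q 2 1 := by
  rw [blockDoF_eq, blockDoF_eq]
  have hd1 : dev q 1 = 1 + q ^ 2 := by unfold dev; ring
  have hd2 : dev q 2 = 1 - q ^ 4 := by unfold dev; ring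
  have h1 : 1 ≤ dev q (n + 1) := by
    unfold dev
    rw [Odd.neg_pow hn.add_one]
    have : 0 ≤ (q ^ 2) ^ (n + 1) := by positivity
    linarith
  have hf1 : 0 ≤ dev q 1 - q := by rw [hd1]; nlinarith [sq_nonneg (1 - q)]
  have hpoly : q ^ 2 ≤ (1 + q ^ 2 - q) * (1 - q + 2 * q ^ 4) := by
    -- Only the last term can be negative, and only for q < 1/2; there it is at least -1/32, while
    -- the first is at least 7/32.
    have hexp : (1 + q ^ 2 - q) * (1 - q + 2 * q ^ 4) - q ^ 2 =
        (1 - q) ^ 2 * (1 - q ^ 3) + q ^ 5 * (2 * q - 1) := by ring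
    have h3 : q ^ 3 ≤ 1 := pow_le_one₀ hq0 hq1
    rcases le_total (1 / 2) q with hq | hq
    · have e1 : 0 ≤ (1 - q) ^ 2 * (1 - q ^ 3) := mul_nonneg (sq_nonneg _) (by linarith)
      have e2 : 0 ≤ q ^ 5 * (2 * q - 1) := mul_nonneg (by positivity) (by linarith)
      linarith
    · have e1 : (1 / 2) ^ 2 ≤ (1 - q) ^ 2 := pow_le_pow_left₀ (by norm_num) (by linarith) 2
      have e2 : q ^ 3 ≤ (1 / 2) ^ 3 := pow_le_pow_left₀ hq0 hq 3
      have e3 : q ^ 5 ≤ (1 / 2) ^ 5 := pow_le_pow_left₀ hq0 hq 5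
      have e4 : (1 / 2) ^ 2 * (1 - (1 / 2) ^ 3) ≤ (1 - q) ^ 2 * (1 - q ^ 3) :=
        mul_le_mul e1 (by linarith) (by norm_num) (sq_nonneg _)
      have e5 : 0 ≤ q ^ 5 * (2 * q) := by positivity
      norm_num at e3 e4
      linarith
  have h2 : rate q ^ 2 * (q ^ 2 - (dev q 1 - q) * (dev q (n + 1) - q)) ≤
      rate q ^ 2 * (2 / 3 * (q ^ 2 - (dev q 2 - q) * (dev q 1 - q))) := by
    refine mul_le_mul_of_nonneg_left ?_ (sq_nonneg _)
    rw [hd1] at hf1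
    rw [hd1, hd2]
    nlinarith [mul_nonneg (sub_nonneg.2 h1) hf1]
  push_cast
  linarith

/-! ### Sums of activation probabilities -/

theorem activeProb_mem {q : ℝ} (hq0 : 0 ≤ q) (hq1 : q ≤ 1) (c : ℕ → Bool) (i : ℕ) :
    0 ≤ activeProb q c i ∧ activeProb q c i ≤ 1 := by
  induction i with
  | zero => exact ⟨hq0, hq1⟩
  | succ i ih =>
    rw [activeProb]
    obtain ⟨h0, h1⟩ := ih
    set e : ℝ := if c (i + 1) then (if c i then q else 1) else (if c i then 0 else q) with he
    have he0 : 0 ≤ e := by rw [he]; split_ifs <;> linarith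
    have he1 : e ≤ 1 := by rw [he]; split_ifs <;> linarith
    have h2 : 0 ≤ e * activeProb q c i := mul_nonneg he0 h0
    have h3 : e * activeProb q c i ≤ 1 := mul_le_one₀ he1 h0 h1
    constructor
    · exact mul_nonneg hq0 (by linarith)
    · exact mul_le_one₀ hq1 (by linarith) (by linarith)

theorem activeProb_congr (q : ℝ) {c c' : ℕ → Bool} {i : ℕ} (h : ∀ j ≤ i, c j = c' j) :
    activeProb q c i = activeProb q c' i := by
  induction i with
  | zero => rfl
  | succ i ih =>
    rw [activeProb, activeProb, ih fun j hj => h j (by omega), h i (by omega), h (i + 1) le_rfl]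

/-- After a transmitter without messages, the schedule starts afresh. -/
theorem activeProb_add (q : ℝ) {c : ℕ → Bool} {k : ℕ} (hk : c k = true)
    (hk' : c (k + 1) = false) (j : ℕ) :
    activeProb q c (k + 1 + j) = activeProb q (fun i => c (k + 1 + i)) j := by
  induction j with
  | zero => simp [activeProb, hk, hk']
  | succ j ih =>
    rw [← add_assoc, activeProb, activeProb, ih]
    simp [add_assoc]

/-- The increments of the block values. -/
def blockStep (q : ℝ) (a b : ℕ) : ℝ := blockDoF q a b - blockDoF q a (b - 1)

theorem dev_zero (q : ℝ) : dev q 0 = 0 := by simp [dev]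

theorem dev_succ (q : ℝ) (a : ℕ) : dev q (a + 1) = 1 + q ^ 2 - q ^ 2 * dev q a := by
  unfold dev; ring

theorem blockDoF_zero_succ (q : ℝ) (a : ℕ) :
    blockDoF q (a + 1) 0 = blockDoF q a 0 + rate q * dev q (a + 1) := by
  have h := rate_mul q
  unfold blockDoF
  rw [dev_zero, dev_succ]
  push_cast
  linear_combination (rate q * (1 - dev q a)) * q * h

/-- Solves the recursion on the initial zeros of a block: the probabilities are `rate q * dev q (a +
1)`, the increments in `blockDoF_zero_succ`. -/
theorem rate_dev_succ (q : ℝ) (a : ℕ) :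
    rate q * dev q (a + 1) = q * (1 - q * (rate q * dev q a)) := by
  have h := rate_mul q
  rw [dev_succ]
  linear_combination h

/-- The step from 0 to 1, where two messages share a transmitter and the conflict is certain (e =
1). -/
theorem blockStep_one (q : ℝ) (a : ℕ) :
    blockStep q a 1 = q * (1 - rate q * dev q a) := by
  have h := rate_mul q
  unfold blockStep blockDoF
  have : dev q 1 = 1 + q ^ 2 := by unfold dev; ring
  rw [this]
  simp only [Nat.sub_self, dev_zero]
  push_cast
  linear_combination (rate q * q - rate q * dev q a + 1 ) * h

theorem blockStep_succ (q : ℝ) (a b : ℕ) (hb : 1 ≤ b) :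
    blockStep q a (b + 1) = q * (1 - q * blockStep q a b) := by
  obtain ⟨b, rfl⟩ : ∃ k, b = k + 1 := ⟨b - 1, by omega⟩
  have h := rate_mul q
  unfold blockStep blockDoF
  simp only [Nat.add_sub_cancel]
  rw [dev_succ q (b + 1), dev_succ q b]
  push_cast
  linear_combination h

theorem sum_activeProb_le {q : ℝ} (hq0 : 0 ≤ q) (hq1 : q ≤ 1) {M : ℝ} (h1 : rate q ≤ M)
    (h2 : blockDoF q 2 1 / 3 ≤ M) (h3 : blockDoF q 2 2 / 4 ≤ M) {c : ℕ → Bool}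
    (hc : c 0 = false) (K : ℕ) :
    ∑ i ∈ Finset.range K, activeProb q c i ≤ K * M + 1 := by
  have hr0 := rate_nonneg hq0
  -- Here m counts the users in completed blocks, already bounded by `M` each; the current block is
  -- kept exactly until a step 1 → 0 closes it.
  have main : ∀ k : ℕ,
      (c k = false ∧ ∃ m a : ℕ, m + a = k ∧ activeProb q c k = rate q * dev q (a + 1) ∧
        ∑ i ∈ Finset.range (k + 1), activeProb q c i ≤ m * M + blockDoF q (a + 1) 0) ∨
      (c k = true ∧ ∃ m a b : ℕ, 1 ≤ a ∧ 1 ≤ b ∧ m + a + b = k + 1 ∧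
        activeProb q c k = blockStep q a b ∧
        ∑ i ∈ Finset.range (k + 1), activeProb q c i ≤ m * M + blockDoF q a b) := by
    have hone : q = rate q * dev q (0 + 1) := by
      rw [rate_dev_succ, dev_zero]; ring
    have hzero : blockDoF q 0 0 = 0 := by simp [blockDoF, dev_zero]
    intro k
    induction k with
    | zero =>
      refine Or.inl ⟨hc, 0, 0, rfl, hone, ?_⟩
      rw [blockDoF_zero_succ, hzero, ← hone]
      simp [activeProb]
    | succ k ih =>
      rw [Finset.sum_range_succ _ (k + 1)]
      rcases ih with ⟨hck, m, a, hk, hu, hs⟩ | ⟨hck, m, a, b, ha, hb, hk, hu, hs⟩ <;>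
        cases hck' : c (k + 1)
      · have hu' : activeProb q c (k + 1) = rate q * dev q (a + 1 + 1) := by
          rw [activeProb, hck, hck', hu, rate_dev_succ q (a + 1)]; simp
        refine Or.inl ⟨rfl, m, a + 1, by omega, hu', ?_⟩
        rw [hu', blockDoF_zero_succ q (a + 1)]
        linarith
      · have hu' : activeProb q c (k + 1) = blockStep q (a + 1) 1 := by
          rw [activeProb, hck, hck', hu, blockStep_one]; simp
        refine Or.inr ⟨rfl, m, a + 1, 1, by omega, le_rfl, by omega, hu', ?_⟩
        rw [hu', blockStep]
        simp only [Nat.sub_self]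
        linarith
      · have hu' : activeProb q c (k + 1) = q := by
          rw [activeProb, hck, hck']; simp
        refine Or.inl ⟨rfl, m + a + b, 0, by omega, hu'.trans hone, ?_⟩
        rw [hu', blockDoF_zero_succ, hzero, ← hone]
        have := blockDoF_le hq0 hq1 h1 h2 h3 ha hb
        push_cast
        linarith
      · have hu' : activeProb q c (k + 1) = blockStep q a (b + 1) := by
          rw [activeProb, hck, hck', hu, blockStep_succ q a b hb]; simp
        refine Or.inr ⟨rfl, m, a, b + 1, ha, by omega, by omega, hu', ?_⟩
        rw [hu', blockStep]
        simp only [Nat.add_sub_cancel]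
        linarith
  cases K with
  | zero => simp
  | succ k =>
    rcases main k with ⟨-, m, a, hk, -, hs⟩ | ⟨-, m, a, b, ha, hb, hk, -, hs⟩
    · have hk' : ((k + 1 : ℕ) : ℝ) = m + (a + 1) := by rw [← hk]; push_cast; ring
      rw [hk']
      -- A final block without ones escapes `blockDoF_le`; its excess is at most (1/2)²·2, which is
      -- where the additive 1 comes from.
      have hb : blockDoF q (a + 1) 0 ≤ (a + 1) * M + 1 := by
        unfold blockDoF
        rw [dev_zero]
        have e1 : rate q ^ 2 ≤ (1 / 2) ^ 2 := pow_le_pow_left₀ hr0 (rate_le_half q) 2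
        have e2 : q * dev q (a + 1) ≤ 1 * 2 :=
          mul_le_mul hq1 (dev_le_two hq0 hq1 _) (dev_nonneg hq0 hq1 _) (by norm_num)
        have e3 : 0 ≤ q * dev q (a + 1) := mul_nonneg hq0 (dev_nonneg hq0 hq1 _)
        have e4 : rate q ^ 2 * (q * dev q (a + 1)) ≤ (1 / 2) ^ 2 * (1 * 2) :=
          mul_le_mul e1 e2 e3 (by norm_num)
        have e5 : ((a : ℝ) + 1) * rate q ≤ (a + 1) * M :=
          mul_le_mul_of_nonneg_left h1 (by positivity)
        push_cast
        linarith
      linarith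
    · have hk' : ((k + 1 : ℕ) : ℝ) = m + a + b := by rw [← hk]; push_cast; ring
      rw [hk']
      have := blockDoF_le hq0 hq1 h1 h2 h3 ha hb
      linarith

/-- The users of a single block. -/
theorem sum_activeProb_block (q : ℝ) {c : ℕ → Bool} (a b : ℕ)
    (hc : ∀ i < a + 1 + b, c i = decide (a < i)) :
    ∑ i ∈ Finset.range (a + 1 + b), activeProb q c i = blockDoF q (a + 1) b := by
  have hone : q = rate q * dev q (0 + 1) := by
    rw [rate_dev_succ, dev_zero]; ring
  have hzero : blockDoF q 0 0 = 0 := by simp [blockDoF, dev_zero]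
  have first : ∀ k ≤ a, activeProb q c k = rate q * dev q (k + 1) ∧
      ∑ i ∈ Finset.range (k + 1), activeProb q c i = blockDoF q (k + 1) 0 := by
    intro k
    induction k with
    | zero =>
      intro _
      refine ⟨hone, ?_⟩
      rw [blockDoF_zero_succ, hzero, ← hone]
      simp [activeProb]
    | succ k ih =>
      intro hk
      obtain ⟨h1, h2⟩ := ih (by omega)
      have hu' : activeProb q c (k + 1) = rate q * dev q (k + 1 + 1) := by
        rw [activeProb, hc k (by omega), hc (k + 1) (by omega), h1, rate_dev_succ q (k + 1)]
        simp [show ¬ a < k by omega, show ¬ a < k + 1 by omega]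
      refine ⟨hu', ?_⟩
      rw [Finset.sum_range_succ, h2, hu', ← blockDoF_zero_succ]
  have second : ∀ k, k + 1 ≤ b → activeProb q c (a + 1 + k) = blockStep q (a + 1) (k + 1) ∧
      ∑ i ∈ Finset.range (a + 1 + k + 1), activeProb q c i = blockDoF q (a + 1) (k + 1) := by
    intro k
    induction k with
    | zero =>
      intro hk
      obtain ⟨h1, h2⟩ := first a le_rfl
      have hu' : activeProb q c (a + 1) = blockStep q (a + 1) (0 + 1) := by
        rw [activeProb, hc a (by omega), hc (a + 1) (by omega), h1, blockStep_one]
        simp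
      refine ⟨hu', ?_⟩
      rw [add_zero, Finset.sum_range_succ, h2, hu', blockStep]
      simp
    | succ k ih =>
      intro hk
      obtain ⟨h1, h2⟩ := ih (by omega)
      have hu' : activeProb q c (a + 1 + (k + 1)) = blockStep q (a + 1) (k + 1 + 1) := by
        rw [← add_assoc, activeProb, hc _ (by omega), hc _ (by omega), h1,
          blockStep_succ q (a + 1) (k + 1) (by omega)]
        simp [show a < a + 1 + k by omega, show a < a + 1 + k + 1 by omega]
      refine ⟨hu', ?_⟩
      rw [← add_assoc] at hu' ⊢
      rw [Finset.sum_range_succ, h2, hu', blockStep]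
      simp
  cases b with
  | zero => exact (first a le_rfl).2
  | succ b => exact (second b le_rfl).2

/-- If all messages are at their own transmitters, the sum is `K * rate q` up to a bounded
error. -/
theorem abs_sum_activeProb_sub_le {q : ℝ} (hq0 : 0 ≤ q) (hq1 : q ≤ 1) (K : ℕ) :
    |∑ i ∈ Finset.range K, activeProb q (fun _ => false) i - K * rate q| ≤ 1 := by
  cases K with
  | zero => simp
  | succ k =>
    have h := sum_activeProb_block q (c := fun i => decide (k < i)) k 0 (fun _ _ => rfl)
    have h' : ∑ i ∈ Finset.range (k + 1), activeProb q (fun _ => false) i =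
        blockDoF q (k + 1) 0 := by
      rw [← h]
      refine Finset.sum_congr rfl fun i hi => activeProb_congr q fun j hj => ?_
      rw [Finset.mem_range] at hi
      simp
      omega
    have hr0 := rate_nonneg hq0
    have e1 : rate q ^ 2 ≤ (1 / 2) ^ 2 := pow_le_pow_left₀ hr0 (rate_le_half q) 2
    have e2 : q * dev q (k + 1) ≤ 1 * 2 :=
      mul_le_mul hq1 (dev_le_two hq0 hq1 _) (dev_nonneg hq0 hq1 _) (by norm_num)
    have e3 : 0 ≤ q * dev q (k + 1) := mul_nonneg hq0 (dev_nonneg hq0 hq1 _)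
    have e4 : rate q ^ 2 * (q * dev q (k + 1)) ≤ (1 / 2) ^ 2 * (1 * 2) :=
      mul_le_mul e1 e2 e3 (by norm_num)
    have e5 : 0 ≤ rate q ^ 2 * (q * dev q (k + 1)) := mul_nonneg (sq_nonneg _) e3
    rw [h', blockDoF, dev_zero, abs_le]
    push_cast
    constructor <;> linarith

/-- The partial sums of an eventually periodic sequence are linear up to a bounded error. -/
theorem exists_abs_sum_sub_le {f : ℕ → ℝ} {N n : ℕ} (hn : 0 < n)
    (hf : ∀ k, N ≤ k → f (k + n) = f k) :
    ∃ C, ∀ K : ℕ, |∑ i ∈ Finset.range K, f i -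
      K * ((∑ i ∈ Finset.range n, f (N + i)) / n)| ≤ C := by
  set L := (∑ i ∈ Finset.range n, f (N + i)) / n with hL
  have hn' : (n : ℝ) ≠ 0 := by positivity
  have hsum : ∀ k, ∑ i ∈ Finset.range n, f (N + k + i) = n * L := by
    intro k
    induction k with
    | zero => rw [hL]; field_simp; simp
    | succ k ih =>
      rw [← ih]
      have h1 := Finset.sum_range_succ (fun i => f (N + k + i)) n
      have h2 := Finset.sum_range_succ' (fun i => f (N + k + i)) n
      have h3 : ∑ i ∈ Finset.range n, f (N + k + (i + 1)) =
          ∑ i ∈ Finset.range n, f (N + (k + 1) + i) :=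
        Finset.sum_congr rfl fun i _ => by congr 1; omega
      rw [hf _ (by omega)] at h1
      rw [h1, h3, add_zero] at h2
      linarith
  set D : ℕ → ℝ := fun K => ∑ i ∈ Finset.range K, f i - K * L with hD
  -- The error is periodic from `N` on, so its first N + n values bound it.
  have hper : ∀ k, N ≤ k → D (k + n) = D k := by
    intro k hk
    obtain ⟨j, rfl⟩ := Nat.exists_eq_add_of_le hk
    simp only [hD]
    rw [Finset.sum_range_add, hsum]
    push_cast
    ring
  refine ⟨∑ i ∈ Finset.range (N + n), |D i|, fun K => ?_⟩
  change |D K| ≤ _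
  induction K using Nat.strong_induction_on with
  | _ K ih =>
    by_cases hK : K < N + n
    · exact Finset.single_le_sum (f := fun i => |D i|) (fun i _ => abs_nonneg _)
        (Finset.mem_range.2 hK)
    · have : K = K - n + n := by omega
      rw [this, hper _ (by omega)]
      exact ih _ (by omega)

theorem tendsto_div_of_abs_sub_le {F : ℕ → ℝ} {L C : ℝ} {N : ℕ}
    (h : ∀ K : ℕ, N ≤ K → |F K - K * L| ≤ C) :
    Tendsto (fun K : ℕ => F K / (K : ℝ)) atTop (𝓝 L) := by
  have hC : Tendsto (fun K : ℕ => C / (K : ℝ)) atTop (𝓝 0) :=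
    tendsto_const_div_atTop_nhds_zero_nat C
  rw [tendsto_iff_norm_sub_tendsto_zero]
  refine squeeze_zero' (Eventually.of_forall fun _ => norm_nonneg _) ?_ hC
  filter_upwards [eventually_ge_atTop N, eventually_gt_atTop 0] with K hK hK0
  have hK' : (0 : ℝ) < K := by exact_mod_cast hK0
  have : F K / K - L = (F K - K * L) / K := by field_simp
  rw [this, Real.norm_eq_abs, abs_div, abs_of_pos hK']
  exact div_le_div_of_nonneg_right (h K hK) hK'.le

/-! ### The sequence of an irreducible string -/

/-- The binary sequence of the assignments defined by the infinite repetition of `S`. -/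
def stringCode (S : List ℕ) (t : ℕ) : Bool :=
  decide (∑ s ∈ Finset.range t, S.getD (s % S.length) 0 = t + 1)

/-- The first t transmitters carry the first t messages, plus the next one if it is shifted. Thus
the loads determine the code. -/
theorem sum_getD_eq {S : List ℕ} {K : ℕ} {T : Assignment K} (hT : IsIrreducible T)
    (hload : ∀ t : Fin K, load T t = stringLoad S K t) {t : ℕ}
    (ht : t ≤ S.length * (K / S.length)) :
    ∑ s ∈ Finset.range t, S.getD (s % S.length) 0 = t + (code T t).toNat := by
  induction t with
  | zero => simp [code_zero]
  | succ t ih =>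
    have hK : S.length * (K / S.length) ≤ K := Nat.mul_div_le _ _
    have h1 := load_assign (code_zero T) (code_of_le T le_rfl) ⟨t, by omega⟩
    rw [assign_code hT, hload, stringLoad, if_pos (by simp; omega)] at h1
    rw [Finset.sum_range_succ, ih (by omega)]
    simp only at h1
    omega

theorem code_eq_stringCode {S : List ℕ} {K : ℕ} {T : Assignment K} (hT : IsIrreducible T)
    (hload : ∀ t : Fin K, load T t = stringLoad S K t) {t : ℕ}
    (ht : t ≤ S.length * (K / S.length)) : code T t = stringCode S t := by
  rw [stringCode, sum_getD_eq hT hload ht]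
  cases code T t <;> simp

theorem IsIrreducibleString.length_pos {S : List ℕ} (hS : IsIrreducibleString S) :
    0 < S.length := List.length_pos_iff.2 hS.1

theorem stringCode_zero (S : List ℕ) : stringCode S 0 = false := by simp [stringCode]

theorem sum_getD_length (S : List ℕ) :
    ∑ s ∈ Finset.range S.length, S.getD (s % S.length) 0 = S.sum := by
  rw [Finset.sum_range, ← Fin.sum_univ_getElem S]
  refine Finset.sum_congr rfl fun i _ => ?_
  rw [Nat.mod_eq_of_lt i.2]
  simp

theorem stringCode_add_length {S : List ℕ} (hS : S.sum = S.length) (t : ℕ) :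
    stringCode S (S.length + t) = stringCode S t := by
  simp only [stringCode]
  rw [Finset.sum_range_add, sum_getD_length, hS]
  simp only [Nat.add_mod_left, decide_eq_decide]
  omega

theorem stringCode_length_mul {S : List ℕ} (hS : S.sum = S.length) (m : ℕ) :
    stringCode S (S.length * m) = false := by
  induction m with
  | zero => simp [stringCode_zero]
  | succ m ih => rw [Nat.mul_succ, add_comm, stringCode_add_length hS, ih]

/-- The codes agree on the full periods; fewer than `S.length` users remain, and each changes the
sum by at most 1. -/
theorem DefinedBy.abs_avgDoF_sub_le {S : List ℕ} (hS : IsIrreducibleString S)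
    {T : (K : ℕ) → Assignment K} (hT : DefinedBy S T) {p : ℝ} (hp0 : 0 ≤ p) (hp1 : p ≤ 1)
    {K : ℕ} (hK : S.length ≤ K) :
    |avgDoF p (T K) - ∑ i ∈ Finset.range K, activeProb (1 - p) (stringCode S) i| ≤
      S.length := by
  obtain ⟨h1, h2⟩ := hT K hK
  have hq0 : 0 ≤ 1 - p := by linarith
  have hq1 : 1 - p ≤ 1 := by linarith
  have hsplit := Nat.div_add_mod K S.length
  conv_lhs => rw [← assign_code h1, avgDoF_assign (code_zero _)]
  rw [← Finset.sum_sub_distrib]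
  have h3 : ∑ i ∈ Finset.range K, (activeProb (1 - p) (code (T K)) i -
      activeProb (1 - p) (stringCode S) i) =
      ∑ i ∈ Finset.range (S.length * (K / S.length) + K % S.length),
        (activeProb (1 - p) (code (T K)) i - activeProb (1 - p) (stringCode S) i) := by
    rw [hsplit]
  rw [h3, Finset.sum_range_add, Finset.sum_eq_zero, zero_add]
  · refine (Finset.abs_sum_le_sum_abs _ _).trans ?_
    have h4 : ∀ i ∈ Finset.range (K % S.length),
        |activeProb (1 - p) (code (T K)) (S.length * (K / S.length) + i) -
          activeProb (1 - p) (stringCode S) (S.length * (K / S.length) + i)| ≤ 1 := by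
      intro i _
      have e1 := activeProb_mem hq0 hq1 (code (T K)) (S.length * (K / S.length) + i)
      have e2 := activeProb_mem hq0 hq1 (stringCode S) (S.length * (K / S.length) + i)
      rw [abs_le]
      constructor <;> linarith [e1.1, e1.2, e2.1, e2.2]
    refine (Finset.sum_le_sum h4).trans ?_
    simp only [Finset.sum_const, Finset.card_range, nsmul_eq_mul, mul_one, Nat.cast_le]
    exact (Nat.mod_lt _ hS.length_pos).le
  · intro i hi
    rw [Finset.mem_range] at hi
    rw [sub_eq_zero]
    exact activeProb_congr _ fun j hj => code_eq_stringCode h1 h2 (by omega)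

theorem hasStringDoF_of_abs_sub_le {S : List ℕ} (hS : IsIrreducibleString S) {p : ℝ}
    (hp0 : 0 ≤ p) (hp1 : p ≤ 1) {L C : ℝ}
    (h : ∀ K : ℕ, |∑ i ∈ Finset.range K, activeProb (1 - p) (stringCode S) i - K * L| ≤ C) :
    HasStringDoF p S L := by
  refine ⟨hS, fun T hT => tendsto_div_of_abs_sub_le (N := S.length) (C := S.length + C)
    fun K hK => ?_⟩
  exact (abs_sub_le _ _ _).trans (add_le_add (hT.abs_avgDoF_sub_le hS hp0 hp1 hK) (h K))

theorem hasStringDoF_of_stringCode_false {S : List ℕ} (hS : IsIrreducibleString S) {p : ℝ}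
    (hp0 : 0 ≤ p) (hp1 : p ≤ 1) (h : ∀ t, stringCode S t = false) :
    HasStringDoF p S (rate (1 - p)) := by
  have : stringCode S = fun _ => false := funext h
  refine hasStringDoF_of_abs_sub_le hS hp0 hp1 (C := 1) fun K => ?_
  rw [this]
  exact abs_sum_activeProb_sub_le (by linarith) (by linarith) K

/-- The reset recurs in every period, so the activation probabilities are exactly periodic from the
first one on. -/
theorem hasStringDoF_of_reset {S : List ℕ} (hS : IsIrreducibleString S) {p : ℝ}
    (hp0 : 0 ≤ p) (hp1 : p ≤ 1) {k : ℕ} (hk : stringCode S k = true)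
    (hk' : stringCode S (k + 1) = false) :
    HasStringDoF p S ((∑ i ∈ Finset.range S.length,
      activeProb (1 - p) (stringCode S) (k + 1 + i)) / S.length) := by
  have hper := stringCode_add_length hS.2.2.1
  have hper' : ∀ m, k + 1 ≤ m → activeProb (1 - p) (stringCode S) (m + S.length) =
      activeProb (1 - p) (stringCode S) m := by
    intro m hm
    obtain ⟨j, rfl⟩ := Nat.exists_eq_add_of_le hm
    have h1 := activeProb_add (1 - p) ((hper k).trans hk)
      (by rw [add_assoc, hper]; exact hk') j
    rw [show k + 1 + j + S.length = S.length + k + 1 + j by omega, h1,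
      activeProb_add _ hk hk']
    congr 1
    funext i
    rw [show S.length + k + 1 + i = S.length + (k + 1 + i) by omega, hper]
  obtain ⟨C, hC⟩ := exists_abs_sum_sub_le hS.length_pos hper'
  exact hasStringDoF_of_abs_sub_le hS hp0 hp1 hC

theorem IsIrreducibleString.exists_hasStringDoF {S : List ℕ} (hS : IsIrreducibleString S)
    {p : ℝ} (hp0 : 0 ≤ p) (hp1 : p ≤ 1) : ∃ L, HasStringDoF p S L := by
  by_cases h : ∃ k, stringCode S k = true ∧ stringCode S (k + 1) = false
  · obtain ⟨k, hk, hk'⟩ := h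
    exact ⟨_, hasStringDoF_of_reset hS hp0 hp1 hk hk'⟩
  -- Without a reset a one would persist forever, yet the code vanishes at multiples of the length;
  -- hence it is identically false.
  · push Not at h
    refine ⟨_, hasStringDoF_of_stringCode_false hS hp0 hp1 fun t => ?_⟩
    by_contra ht
    rw [Bool.not_eq_false] at ht
    have h1 : ∀ j, stringCode S (t + j) = true := by
      intro j
      induction j with
      | zero => exact ht
      | succ j ih => exact Bool.not_eq_false _ ▸ h _ ih
    have hn := hS.length_pos
    have h2 := h1 (S.length * t - t)
    rw [Nat.add_sub_cancel' (Nat.le_mul_of_pos_left _ hn),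
      stringCode_length_mul hS.2.2.1] at h2
    simp at h2

/-! ### The particular strings -/

theorem isIrreducibleString_one : IsIrreducibleString [1] := by
  refine ⟨by simp, by simp, by simp, fun K => assign (fun _ => false) K, fun K _ => ?_⟩
  refine ⟨isIrreducible_assign rfl K, fun t => ?_⟩
  have := load_assign (c := fun _ => false) rfl (K := K) rfl t
  simp only [Bool.toNat_false, add_zero] at this
  simp [this, stringLoad, Nat.mod_one]

theorem hasStringDoF_one {p : ℝ} (hp0 : 0 ≤ p) (hp1 : p ≤ 1) :
    HasStringDoF p [1] (tau1 p) := by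
  rw [tau1_eq hp0 hp1]
  refine hasStringDoF_of_stringCode_false isIrreducibleString_one hp0 hp1 fun t => ?_
  simp [stringCode, Nat.mod_one]

theorem length_stringTwoMiddle (a b : ℕ) : (stringTwoMiddle a b).length = a + b + 2 := by
  simp [stringTwoMiddle]; omega

theorem getD_stringTwoMiddle (a b : ℕ) {j : ℕ} (hj : j < a + b + 2) :
    (stringTwoMiddle a b).getD j 0 + (decide (a < j)).toNat =
      1 + (decide (a < j + 1 ∧ j + 1 < a + b + 2)).toNat := by
  unfold stringTwoMiddle
  rcases lt_trichotomy j a with h | rfl | h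
  · rw [List.getD_append _ _ _ _ (by simpa using h)]
    simp [h, show ¬ a < j by omega]
  · rw [List.getD_append_right _ _ _ _ (by simp)]
    simp
  · obtain ⟨i, rfl⟩ := Nat.exists_eq_add_of_lt h
    rw [List.getD_append_right _ _ _ _ (by simp; omega)]
    simp only [List.length_replicate, show a + i + 1 - a = i + 1 by omega, List.getD_cons_succ]
    by_cases hi : i < b
    · rw [List.getD_append _ _ _ _ (by simpa using hi)]
      simp [hi, show a ≤ a + i + 1 by omega, show a + i + 1 + 1 < a + b + 2 by omega]
    · have : i = b := by omega
      subst this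
      rw [List.getD_append_right _ _ _ _ (by simp)]
      simp

/-- The binary sequence of the string `(1, …, 1, 2, 1, …, 1, 0)` in the `K`-user network. -/
def twoMiddleCode (a b K t : ℕ) : Bool :=
  -- The second condition ends the pattern with the last full period; the remaining transmitters
  -- have load one.
  decide (a < t % (a + b + 2) ∧ t < (a + b + 2) * (K / (a + b + 2)))

theorem twoMiddleCode_zero (a b K : ℕ) : twoMiddleCode a b K 0 = false := by
  simp [twoMiddleCode]

theorem definedBy_stringTwoMiddle (a b : ℕ) :
    DefinedBy (stringTwoMiddle a b) fun K => assign (twoMiddleCode a b K) K := by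
  intro K _
  refine ⟨isIrreducible_assign (twoMiddleCode_zero a b K) K, fun t => ?_⟩
  have hK : twoMiddleCode a b K K = false := by
    have := Nat.mul_div_le K (a + b + 2)
    simp only [twoMiddleCode, decide_eq_false_iff_not]
    omega
  have h1 := load_assign (twoMiddleCode_zero a b K) hK t
  suffices h : stringLoad (stringTwoMiddle a b) K t + (twoMiddleCode a b K t).toNat =
      1 + (twoMiddleCode a b K (t + 1)).toNat by
    change load (assign (twoMiddleCode a b K) K) t = _
    omega
  clear h1
  obtain ⟨t, ht⟩ := t
  simp only [stringLoad, length_stringTwoMiddle, twoMiddleCode]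
  set n := a + b + 2 with hn
  by_cases h : t < n * (K / n)
  · have hj : t % n < n := Nat.mod_lt _ (by omega)
    have h2 := getD_stringTwoMiddle a b hj
    simp only [h, and_true, if_true]
    rw [h2]
    congr 3
    rw [← hn, Nat.add_mod_eq_ite, Nat.mod_eq_of_lt (show 1 < n by omega)]
    have hdm := Nat.div_add_mod t n
    have hlt : t / n < K / n := by
      by_contra hge
      have := Nat.mul_le_mul_left n (not_lt.1 hge)
      omega
    have hle := Nat.mul_le_mul_left n (Nat.succ_le_of_lt hlt)
    rw [Nat.mul_succ] at hle
    simp only [eq_iff_iff]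
    split_ifs with h3 <;> omega
  · have h' : ¬ t + 1 < n * (K / n) := by omega
    simp [h, h']

theorem isIrreducibleString_stringTwoMiddle (a b : ℕ) :
    IsIrreducibleString (stringTwoMiddle a b) := by
  refine ⟨by simp [stringTwoMiddle], ?_, ?_, _, definedBy_stringTwoMiddle a b⟩
  · intro s hs
    simp only [stringTwoMiddle, List.mem_append, List.mem_cons, List.mem_replicate,
      List.not_mem_nil, or_false] at hs
    omega
  · rw [length_stringTwoMiddle]
    simp [stringTwoMiddle]
    omega

theorem code_assign {c : ℕ → Bool} (hc : c 0 = false) {K i : ℕ} (hi : i < K) :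
    code (assign c K) i = c i := by
  have h := code_val (assign c K) ⟨i, hi⟩
  simp only [mem_assign hc] at h
  rw [Bool.eq_iff_iff, h]
  constructor
  · rintro ⟨t, h1, h2⟩
    cases hci : c i
    · rw [hci] at h1
      simp at h1
      omega
    · rfl
  · intro hci
    have : i ≠ 0 := by rintro rfl; rw [hc] at hci; simp at hci
    exact ⟨⟨i - 1, by omega⟩, by simp [hci]; omega, by simp; omega⟩

theorem stringCode_stringTwoMiddle (a b : ℕ) {i : ℕ} (hi : i < a + b + 2) :
    stringCode (stringTwoMiddle a b) i = decide (a < i) := by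
  have hl := length_stringTwoMiddle a b
  obtain ⟨h1, h2⟩ := definedBy_stringTwoMiddle a b (a + b + 2) hl.le
  rw [← code_eq_stringCode h1 h2, code_assign (twoMiddleCode_zero _ _ _) hi]
  · simp [twoMiddleCode, Nat.mod_eq_of_lt hi, hi]
  · rw [hl, Nat.div_self (by omega)]
    omega

/-- One period is the single block 0^(a+1) 1^(b+1), followed by a reset. -/
theorem hasStringDoF_stringTwoMiddle {p : ℝ} (hp0 : 0 ≤ p) (hp1 : p ≤ 1) (a b : ℕ) :
    HasStringDoF p (stringTwoMiddle a b)
      (blockDoF (1 - p) (a + 1) (b + 1) / ((a + b + 2 : ℕ) : ℝ)) := by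
  have hS := isIrreducibleString_stringTwoMiddle a b
  have hl := length_stringTwoMiddle a b
  have hper := stringCode_add_length hS.2.2.1
  have hk : stringCode (stringTwoMiddle a b) (a + b + 1) = true := by
    rw [stringCode_stringTwoMiddle a b (by omega)]; simp
  have hk' : stringCode (stringTwoMiddle a b) (a + b + 1 + 1) = false := by
    rw [show a + b + 1 + 1 = (stringTwoMiddle a b).length + 0 by omega, hper, stringCode_zero]
  have h := hasStringDoF_of_reset hS hp0 hp1 hk hk'
  rw [hl] at h
  rw [← sum_activeProb_block (1 - p) (c := stringCode (stringTwoMiddle a b)) a (b + 1)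
    (fun i hi => stringCode_stringTwoMiddle a b (by omega)),
    show a + 1 + (b + 1) = a + b + 2 by omega]
  convert h using 2
  refine Finset.sum_congr rfl fun i _ => ?_
  rw [activeProb_add _ hk hk']
  congr 1
  funext j
  rw [← hper j, hl]

theorem stringTwoFirst_eq (n : ℕ) : stringTwoFirst n = stringTwoMiddle 0 n := rfl

theorem stringTwoLast_eq (n : ℕ) : stringTwoLast n = stringTwoMiddle n 0 := rfl

theorem hasStringDoF_two_one_zero {p : ℝ} (hp0 : 0 ≤ p) (hp1 : p ≤ 1) :
    HasStringDoF p [2, 1, 0] (tau2 p) := by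
  have h := hasStringDoF_stringTwoMiddle hp0 hp1 0 1
  rw [blockDoF_comm] at h
  rw [tau2_eq]
  norm_num at h
  exact h

theorem hasStringDoF_one_two_one_zero {p : ℝ} (hp0 : 0 ≤ p) (hp1 : p ≤ 1) :
    HasStringDoF p [1, 2, 1, 0] (tau3 p) := by
  have h := hasStringDoF_stringTwoMiddle hp0 hp1 1 1
  rw [tau3_eq]
  norm_num at h
  exact h

/-! ### The optimal assignment -/

theorem avgDoF_le_bestAvgDoF (p : ℝ) {K : ℕ} {T : Assignment K} (hT : CoopOrder 1 T) :
    avgDoF p T ≤ bestAvgDoF p K :=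
  le_ciSup (f := fun T : {T : Assignment K // CoopOrder 1 T} => avgDoF p T.1)
    (Set.finite_range _).bddAbove ⟨T, hT⟩

theorem bestAvgDoF_le {p : ℝ} (hp0 : 0 ≤ p) (hp1 : p ≤ 1) (K : ℕ) :
    bestAvgDoF p K ≤ K * max (max (tau1 p) (tau2 p)) (tau3 p) + 1 := by
  have : Nonempty {T : Assignment K // CoopOrder 1 T} := ⟨⟨fun _ => ∅, fun _ => by simp⟩⟩
  refine ciSup_le fun T => ?_
  refine (avgDoF_le_assign_code hp0 hp1 T.2).trans ?_
  rw [avgDoF_assign (code_zero _)]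
  refine sum_activeProb_le (by linarith) (by linarith) ?_ ?_ ?_ (code_zero _) K
  · rw [← tau1_eq hp0 hp1]; simp
  · rw [← tau2_eq]; simp
  · rw [← tau3_eq]; simp

theorem HasStringDoF.exists_le_bestAvgDoF {p : ℝ} {S : List ℕ} {L : ℝ}
    (h : HasStringDoF p S L) :
    ∃ f : ℕ → ℝ, Tendsto f atTop (𝓝 L) ∧ ∀ᶠ K : ℕ in atTop, f K ≤ bestAvgDoF p K / K := by
  obtain ⟨⟨-, -, -, T, hT⟩, hlim⟩ := h
  refine ⟨_, hlim T hT, ?_⟩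
  filter_upwards [eventually_ge_atTop S.length] with K hK
  exact div_le_div_of_nonneg_right (avgDoF_le_bestAvgDoF p (hT K hK).1.coopOrder)
    (Nat.cast_nonneg K)

theorem tendsto_bestAvgDoF {p : ℝ} (hp0 : 0 ≤ p) (hp1 : p ≤ 1) :
    Tendsto (fun K : ℕ => bestAvgDoF p K / (K : ℝ)) atTop
      (𝓝 (max (max (tau1 p) (tau2 p)) (tau3 p))) := by
  obtain ⟨f₁, h₁, h₁'⟩ := (hasStringDoF_one hp0 hp1).exists_le_bestAvgDoF
  obtain ⟨f₂, h₂, h₂'⟩ := (hasStringDoF_two_one_zero hp0 hp1).exists_le_bestAvgDoF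
  obtain ⟨f₃, h₃, h₃'⟩ := (hasStringDoF_one_two_one_zero hp0 hp1).exists_le_bestAvgDoF
  set M := max (max (tau1 p) (tau2 p)) (tau3 p) with hM
  have hup : Tendsto (fun K : ℕ => M + 1 / (K : ℝ)) atTop (𝓝 M) := by
    simpa using (tendsto_const_nhds (x := M)).add (tendsto_const_div_atTop_nhds_zero_nat (1 : ℝ))
  refine tendsto_of_tendsto_of_tendsto_of_le_of_le' ((h₁.max h₂).max h₃) hup ?_ ?_
  · filter_upwards [h₁', h₂', h₃'] with K e₁ e₂ e₃
    exact max_le (max_le e₁ e₂) e₃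
  · filter_upwards [eventually_gt_atTop 0] with K hK
    have hK' : (0 : ℝ) < K := by exact_mod_cast hK
    rw [div_le_iff₀ hK', add_mul, div_mul_cancel₀ _ hK'.ne', mul_comm M]
    exact bestAvgDoF_le hp0 hp1 K

/-- The assignments of a string compete in `bestAvgDoF`, so the bound passes to the limit. -/
theorem HasStringDoF.le_max {p : ℝ} (hp0 : 0 ≤ p) (hp1 : p ≤ 1) {S : List ℕ} {L : ℝ}
    (h : HasStringDoF p S L) : L ≤ max (max (tau1 p) (tau2 p)) (tau3 p) := by
  obtain ⟨f, hf, hf'⟩ := h.exists_le_bestAvgDoF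
  exact le_of_tendsto_of_tendsto hf (tendsto_bestAvgDoF hp0 hp1) hf'

theorem exists_convex_combination_of_le_max {L x y z : ℝ} (h : L ≤ max (max x y) z) :
    ∃ w₁ w₂ w₃ : ℝ, 0 ≤ w₁ ∧ 0 ≤ w₂ ∧ 0 ≤ w₃ ∧ w₁ + w₂ + w₃ = 1 ∧
      L ≤ w₁ * x + w₂ * y + w₃ * z := by
  rcases le_max_iff.1 h with h | h
  · rcases le_max_iff.1 h with h | h
    · exact ⟨1, 0, 0, by simpa using h⟩
    · exact ⟨0, 1, 0, by simpa using h⟩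
  · exact ⟨0, 0, 1, by simpa using h⟩

end WynerTDMA

end

theorem theorem1 (p : ℝ) (hp0 : 0 ≤ p) (hp1 : p ≤ 1) :
    -- the optimal average per user DoF
    Tendsto (fun K : ℕ => WynerTDMA.bestAvgDoF p K / (K : ℝ)) atTop
      (𝓝 (max (max (WynerTDMA.tau1 p) (WynerTDMA.tau2 p)) (WynerTDMA.tau3 p))) ∧
    -- the three values are those of the strategies `(1)`, `(2,1,0)` and `(1,2,1,0)`
    WynerTDMA.HasStringDoF p [1] (WynerTDMA.tau1 p) ∧
    WynerTDMA.HasStringDoF p [2, 1, 0] (WynerTDMA.tau2 p) ∧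
    WynerTDMA.HasStringDoF p [1, 2, 1, 0] (WynerTDMA.tau3 p) ∧
    -- the strings `(2,1,…,1,0)` and `(1,…,1,2,0)` with `n` ones
    (∀ n : ℕ, ∃ L : ℝ,
      WynerTDMA.HasStringDoF p (WynerTDMA.stringTwoFirst n) L ∧
      WynerTDMA.HasStringDoF p (WynerTDMA.stringTwoLast n) L ∧
      (Odd n → L ≤ ((n : ℝ) - 1) / ((n : ℝ) + 2) * WynerTDMA.tau1 p +
        3 / ((n : ℝ) + 2) * WynerTDMA.tau2 p) ∧
      (Even n → L ≤ (n : ℝ) / ((n : ℝ) + 2) * WynerTDMA.tau1 p +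
        2 / ((n : ℝ) + 2) * WynerTDMA.tau2 p)) ∧
    -- the strings `(1,…,1,2,1,…,1,0)` are irreducible
    (∀ a b : ℕ, 1 ≤ a → 1 ≤ b →
      WynerTDMA.IsIrreducibleString (WynerTDMA.stringTwoMiddle a b)) ∧
    -- every irreducible string is bounded by a convex combination of the three values
    (∀ S : List ℕ, WynerTDMA.IsIrreducibleString S →
      ∃ L w₁ w₂ w₃ : ℝ, WynerTDMA.HasStringDoF p S L ∧
        0 ≤ w₁ ∧ 0 ≤ w₂ ∧ 0 ≤ w₃ ∧ w₁ + w₂ + w₃ = 1 ∧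
        L ≤ w₁ * WynerTDMA.tau1 p + w₂ * WynerTDMA.tau2 p + w₃ * WynerTDMA.tau3 p) := by
  refine ⟨WynerTDMA.tendsto_bestAvgDoF hp0 hp1, WynerTDMA.hasStringDoF_one hp0 hp1,
    WynerTDMA.hasStringDoF_two_one_zero hp0 hp1,
    WynerTDMA.hasStringDoF_one_two_one_zero hp0 hp1, fun n => ?_,
    fun a b _ _ => WynerTDMA.isIrreducibleString_stringTwoMiddle a b, fun S hS => ?_⟩
  · have hq0 : 0 ≤ 1 - p := by linarith
    have hq1 : 1 - p ≤ 1 := by linarith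
    have hn : (0 : ℝ) < n + 2 := by positivity
    have h1 := WynerTDMA.hasStringDoF_stringTwoMiddle hp0 hp1 0 n
    have h2 := WynerTDMA.hasStringDoF_stringTwoMiddle hp0 hp1 n 0
    -- The symmetry of the block value in a and b is why the two strings have the same DoF.
    rw [WynerTDMA.blockDoF_comm] at h2
    rw [show 0 + n + 2 = n + 2 by omega] at h1
    rw [WynerTDMA.stringTwoFirst_eq, WynerTDMA.stringTwoLast_eq, WynerTDMA.tau1_eq hp0 hp1,
      WynerTDMA.tau2_eq]
    refine ⟨_, h1, h2, fun _ => ?_, fun heven => ?_⟩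
    · have h := WynerTDMA.blockDoF_one_le_of_odd hq0 hq1 n
      push_cast
      rw [div_le_iff₀ hn]
      field_simp
      linarith
    · have h := WynerTDMA.blockDoF_one_le_of_even hq0 hq1 heven
      push_cast
      rw [div_le_iff₀ hn]
      field_simp
      linarith
  · obtain ⟨L, hL⟩ := hS.exists_hasStringDoF hp0 hp1
    obtain ⟨w₁, w₂, w₃, h⟩ :=
      WynerTDMA.exists_convex_combination_of_le_max (hL.le_max hp0 hp1)
    exact ⟨L, w₁, w₂, w₃, hL, h⟩
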